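/- For every integer $k\ge 1$ let $f_k:[\frac1{k+1},\frac1k]\to[0,1]$ be the affine decreasing function with $f_k(\frac1{k+1})=1$ and $f_k(\frac1k)=0$, and let $g_k=f_k^{-1}:[0,1]\to[\frac1{k+1},\frac1k]$. For $n\ge1$ let \[ J_n=\bigcap_{l=1}^{\infty}\ \bigcup_{(q_1,\dots,q_l)\in\{1,\dots,n\}^l} g_{q_1}\circ g_{q_2}\circ\dots\circ g_{q_l}([0,1]) \] be the limit set of the iterated function system $\{g_1,\dots,g_n\}$. For $E\subset\mathbb R$ and $\delta>0$, a $\delta$-packing of $E$ is a countable family of pairwise disjoint closed balls with centers in $E$ and positive radii at most $\delta$. For $s\ge 0$ put \[ P^{\mathrm{pre}}_s(E)=\inf_{\delta>0}\ \sup\Big\{\sum_{B\in\mathcal R}|B|^s:\ \mathcal R\text{ is a }\delta\text{-packing of }E\Big\}, \qquad \mathcal P_s(E)=\inf\Big\{\sum_{i=1}^\infty P^{\mathrm{pre}}_s(E_i):\ E\subset\bigcup_{i=1}^\infty E_i\Big\}, \] where $|B|$ is the diameter of $B$; $\mathcal P_s$ is the $s$-dimensional packing measure. Let $h_n=\inf\{s\ge0:\mathcal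 P_s(J_n)=0\}$ be the packing dimension of $J_n$. Then \[ \limsup_{n\to\infty}\mathcal P_{h_n}(J_n)\le 2 . \] -/

import Mathlib

open Set Filter Topology
open scoped ENNReal

noncomputable section

/-- `gaussLin k` is the affine function `f_k` with `f_k (1/(k+1)) = 1` and `f_k (1/k) = 0`,
considered on `[1/(k+1), 1/k]`, for `k ≥ 1`. -/
def gaussLin (k : ℕ) (x : ℝ) : ℝ := (k + 1) * (1 - k * x)

/-- `gaussInv k` is the inverse branch `g_k : [0,1] → [1/(k+1), 1/k]` of `f_k`, for `k ≥ 1`. -/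
def gaussInv (k : ℕ) (y : ℝ) : ℝ := 1 / k - (1 / k - 1 / (k + 1)) * y

theorem gaussLin_left (k : ℕ) : gaussLin k (1 / ((k : ℝ) + 1)) = 1 := by
  have h : (k : ℝ) + 1 ≠ 0 := by positivity
  unfold gaussLin
  field_simp
  ring

theorem gaussLin_right {k : ℕ} (hk : 1 ≤ k) : gaussLin k (1 / (k : ℝ)) = 0 := by
  have h : (k : ℝ) ≠ 0 := by positivity
  unfold gaussLin
  field_simp
  ring

theorem gaussLin_gaussInv {k : ℕ} (hk : 1 ≤ k) (y : ℝ) : gaussLin k (gaussInv k y) = y := by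
  have h : (k : ℝ) ≠ 0 := by positivity
  have h' : (k : ℝ) + 1 ≠ 0 := by positivity
  unfold gaussLin gaussInv
  field_simp
  ring

theorem gaussInv_gaussLin {k : ℕ} (hk : 1 ≤ k) (x : ℝ) : gaussInv k (gaussLin k x) = x := by
  have h : (k : ℝ) ≠ 0 := by positivity
  have h' : (k : ℝ) + 1 ≠ 0 := by positivity
  unfold gaussLin gaussInv
  field_simp
  ring

/-- The composition `g_{q₁} ∘ g_{q₂} ∘ ⋯ ∘ g_{q_l}` along the word `[q₁, …, q_l]`. -/
def wordMap : List ℕ → ℝ → ℝ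
  | [] => id
  | k :: w => gaussInv k ∘ wordMap w

/-- The limit set `J_n` of the system `{g_1, …, g_n}`: the intersection over `l ≥ 1` of the union
of the images of `[0,1]` under all words of length `l` with letters in `{1, …, n}`. -/
def limitSet (n : ℕ) : Set ℝ :=
  ⋂ (l : ℕ) (_ : 1 ≤ l), ⋃ (w : List ℕ) (_ : w.length = l ∧ ∀ k ∈ w, 1 ≤ k ∧ k ≤ n),
    wordMap w '' Icc (0 : ℝ) 1

/-- `R` is (the set of pairs (center, radius) of) a `δ`-packing of `E`: a countable family of
pairwise disjoint closed balls of radii at most `δ` with centers in `E`. -/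
structure IsPacking (δ : ℝ) (E : Set ℝ) (R : Set (ℝ × ℝ)) : Prop where
  countable : R.Countable
  center_mem : ∀ p ∈ R, p.1 ∈ E
  radius_pos : ∀ p ∈ R, 0 < p.2
  radius_le : ∀ p ∈ R, p.2 ≤ δ
  disjoint : R.PairwiseDisjoint fun p => Metric.closedBall p.1 p.2

/-- `P_δ^s(E)`: the supremum of `∑ |B|^s` over the `δ`-packings of `E`. -/
def packingSup (s δ : ℝ) (E : Set ℝ) : ℝ≥0∞ :=
  ⨆ (R : Set (ℝ × ℝ)) (_ : IsPacking δ E R),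
    ∑' p : R, ENNReal.ofReal (Metric.diam (Metric.closedBall p.1.1 p.1.2)) ^ s

/-- The `s`-dimensional packing premeasure. -/
def packingPremeasure (s : ℝ) (E : Set ℝ) : ℝ≥0∞ :=
  ⨅ (δ : ℝ) (_ : 0 < δ), packingSup s δ E

/-- The `s`-dimensional packing measure. -/
def packingMeasure (s : ℝ) (E : Set ℝ) : ℝ≥0∞ :=
  ⨅ (A : ℕ → Set ℝ) (_ : E ⊆ ⋃ i, A i), ∑' i, packingPremeasure s (A i)

/-- The packing dimension of a subset of the line. -/
def packingDim (E : Set ℝ) : ℝ :=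
  sInf {s : ℝ | 0 ≤ s ∧ packingMeasure s E = 0}

end

/-! Let `r_k = 1 / (k (k + 1))` be the ratio of `g_k` and `s ≤ 1` the similarity dimension, `∑ r_k ^
s = 1`. The self-similar measure `μ` with weights `r_k ^ s` satisfies `μ(B(x, r)) ≥ θ r ^ s` for `x
∈ J_n` and `r ≤ 1`, with `θ → 1` as `n → ∞`. Disjoint balls have total mass at most `1`, so packing
sums `∑ (2 r) ^ s` are at most `2 ^ s / θ ≤ 2 / θ`.

The mass bound holds because `μ` is almost Lebesgue measure on `[0,1]`: since `∑ r_k = 1 - 1 / (n +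
1)`, replacing the weights `r_k` by `r_k ^ s` costs only `1 / (n + 1)`, and self-similarity keeps
the accumulated error below `4 / (n + 1)` (`abs_approxCdf_sub_unitClamp_le`). A small ball is
magnified by the maps `f_k` until its radius is at least `1 / 2` or at least the length of the
cylinder containing its center. In the latter case its right half alone has mass nearly `r`; the
left half may lie in the gap `[0, 1 / (n + 1)]` (`approxCdf_sub_ge_of_ratio_le`,
`approxCdf_ball_ge`). The losses are controlled by `r_n ^ (s - 1)`, which tends to `1` because `1 -
s ≤ 2 / n`.

The measure itself is never needed: iterates `F_m` of the self-similarity equation for distribution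
functions suffice, as finite packings see only finitely many scales. The term `1 - F_m` in the
recursion reflects that the branches reverse orientation.

Finally, only `h_n ≥ s` is needed. For `t < s`, Baire's theorem makes some piece of any countable
cover dense in a portion of `J_n`, and such a piece has infinite premeasure
(`packingPremeasure_eq_top`). -/

noncomputable section

/-! ### Branches and their contraction ratios -/

/-- The contraction ratio `1 / (k (k + 1))` of `gaussInv k`. -/
def gaussRatio (k : ℕ) : ℝ := 1 / ((k : ℝ) * (k + 1))

theorem gaussRatio_pos {k : ℕ} (hk : 1 ≤ k) : 0 < gaussRatio k := by
  unfold gaussRatio; positivity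

theorem gaussRatio_le_half {k : ℕ} (hk : 1 ≤ k) : gaussRatio k ≤ 1 / 2 := by
  have h : (1 : ℝ) ≤ k := by exact_mod_cast hk
  unfold gaussRatio
  exact one_div_le_one_div_of_le (by norm_num) (by nlinarith)

theorem gaussRatio_eq {k : ℕ} (hk : 1 ≤ k) :
    gaussRatio k = 1 / (k : ℝ) - 1 / ((k : ℝ) + 1) := by
  have h : (k : ℝ) ≠ 0 := by positivity
  unfold gaussRatio
  field_simp
  ring

theorem gaussRatio_anti {j k : ℕ} (hj : 1 ≤ j) (hjk : j ≤ k) : gaussRatio k ≤ gaussRatio j := by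
  have h : (1 : ℝ) ≤ j := by exact_mod_cast hj
  have h' : (j : ℝ) ≤ k := by exact_mod_cast hjk
  unfold gaussRatio
  exact one_div_le_one_div_of_le (by positivity) (by nlinarith)

theorem gaussRatio_le_three_mul {j : ℕ} (hj : 1 ≤ j) :
    gaussRatio j ≤ 3 * gaussRatio (j + 1) := by
  have h : (1 : ℝ) ≤ j := by exact_mod_cast hj
  unfold gaussRatio
  push_cast
  rw [mul_one_div, div_le_div_iff₀ (by positivity) (by positivity)]
  nlinarith

theorem gaussInv_eq {k : ℕ} (hk : 1 ≤ k) (y : ℝ) :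
    gaussInv k y = 1 / (k : ℝ) - gaussRatio k * y := by
  rw [gaussInv, gaussRatio_eq hk]

theorem gaussLin_eq {k : ℕ} (hk : 1 ≤ k) (x : ℝ) :
    gaussLin k x = (1 / (k : ℝ) - x) / gaussRatio k := by
  have h : (k : ℝ) ≠ 0 := by positivity
  unfold gaussLin gaussRatio
  field_simp

theorem gaussLin_antitone (k : ℕ) : Antitone (gaussLin k) := by
  intro x y h
  unfold gaussLin
  have : (k : ℝ) * x ≤ k * y := by gcongr
  have h2 : (0 : ℝ) ≤ k + 1 := by positivity
  nlinarith

theorem gaussLin_pos_iff {k : ℕ} (hk : 1 ≤ k) (x : ℝ) : 0 < gaussLin k x ↔ x < 1 / (k : ℝ) := by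
  rw [gaussLin_eq hk, div_pos_iff_of_pos_right (gaussRatio_pos hk), sub_pos]

theorem gaussLin_lt_one_iff {k : ℕ} (hk : 1 ≤ k) (x : ℝ) :
    gaussLin k x < 1 ↔ 1 / ((k : ℝ) + 1) < x := by
  rw [gaussLin_eq hk, div_lt_one (gaussRatio_pos hk), gaussRatio_eq hk]
  constructor <;> intro h <;> linarith

theorem gaussInv_mem_Icc {k : ℕ} (hk : 1 ≤ k) {y : ℝ} (hy : y ∈ Icc (0 : ℝ) 1) :
    gaussInv k y ∈ Icc (1 / ((k : ℝ) + 1)) (1 / k) := by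
  have h := gaussRatio_pos hk
  have h' := gaussRatio_eq hk
  rw [gaussInv_eq hk]
  constructor
  · nlinarith [hy.2]
  · nlinarith [hy.1]

/-! ### Distribution functions of the self-similar measure -/

/-- Truncation of the identity to `[0,1]`. -/
def unitClamp (x : ℝ) : ℝ := max 0 (min 1 x)

theorem unitClamp_of_nonpos {x : ℝ} (h : x ≤ 0) : unitClamp x = 0 := by
  unfold unitClamp; simp [h]

theorem unitClamp_of_one_le {x : ℝ} (h : 1 ≤ x) : unitClamp x = 1 := by
  unfold unitClamp; simp [h]

theorem unitClamp_of_mem {x : ℝ} (h0 : 0 ≤ x) (h : x ≤ 1) : unitClamp x = x := by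
  unfold unitClamp; simp [h, h0]

theorem unitClamp_monotone : Monotone unitClamp := fun x y h => by
  unfold unitClamp; gcongr

/-- Both sides are the length of the part of `[1/(k+1), 1/k]` to the left of `x`; the form on the
right telescopes over `k`. -/
theorem gaussRatio_mul_one_sub_unitClamp {k : ℕ} (hk : 1 ≤ k) (x : ℝ) :
    gaussRatio k * (1 - unitClamp (gaussLin k x))
      = min (1 / (k : ℝ)) x - min (1 / ((k : ℝ) + 1)) x := by
  have hr := gaussRatio_pos hk
  have he := gaussRatio_eq hk
  rcases le_or_gt (1 / (k : ℝ)) x with h | h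
  · have h1 : gaussLin k x ≤ 0 := not_lt.1 fun h' => absurd ((gaussLin_pos_iff hk x).1 h') h.not_gt
    rw [unitClamp_of_nonpos h1, min_eq_left h, min_eq_left (by linarith)]
    linarith
  · have h0 := (gaussLin_pos_iff hk x).2 h
    rw [min_eq_right h.le]
    rcases le_or_gt x (1 / ((k : ℝ) + 1)) with h' | h'
    · have h1 : 1 ≤ gaussLin k x :=
        not_lt.1 fun h1 => absurd ((gaussLin_lt_one_iff hk x).1 h1) h'.not_gt
      rw [unitClamp_of_one_le h1, min_eq_right h']
      ring
    · have h1 := (gaussLin_lt_one_iff hk x).2 h'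
      rw [unitClamp_of_mem h0.le h1.le, min_eq_left h'.le, gaussLin_eq hk, mul_sub,
        mul_div_cancel₀ _ hr.ne']
      linarith

theorem sum_gaussRatio_mul_one_sub_unitClamp (n : ℕ) (x : ℝ) :
    ∑ k ∈ Finset.Icc 1 n, gaussRatio k * (1 - unitClamp (gaussLin k x))
      = min 1 x - min (1 / ((n : ℝ) + 1)) x := by
  induction n with
  | zero => simp
  | succ n ih =>
    rw [Finset.sum_Icc_succ_top (by omega), ih, gaussRatio_mul_one_sub_unitClamp (by omega)]
    push_cast
    ring

theorem sum_gaussRatio (n : ℕ) :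
    ∑ k ∈ Finset.Icc 1 n, gaussRatio k = 1 - 1 / ((n : ℝ) + 1) := by
  induction n with
  | zero => simp
  | succ n ih =>
    rw [Finset.sum_Icc_succ_top (by omega), ih, gaussRatio_eq (by omega)]
    push_cast
    ring

/-- Approximate distribution functions of the self-similar measure on `limitSet n` that gives
weight `gaussRatio k ^ s` to the `k`-th branch. -/
def approxCdf (n : ℕ) (s : ℝ) : ℕ → ℝ → ℝ
  | 0, x => unitClamp x
  | m + 1, x => ∑ k ∈ Finset.Icc 1 n, gaussRatio k ^ s * (1 - approxCdf n s m (gaussLin k x))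

theorem approxCdf_monotone (n : ℕ) (s : ℝ) (m : ℕ) : Monotone (approxCdf n s m) := by
  induction m with
  | zero => exact unitClamp_monotone
  | succ m ih =>
    intro x y h
    refine Finset.sum_le_sum fun k hk => ?_
    have := ih (gaussLin_antitone k h)
    have h2 := (Real.rpow_pos_of_pos (gaussRatio_pos (Finset.mem_Icc.1 hk).1) s).le
    gcongr

theorem approxCdf_outside {n : ℕ} {s : ℝ} (hs : ∑ k ∈ Finset.Icc 1 n, gaussRatio k ^ s = 1)
    (m : ℕ) : (∀ x ≤ 0, approxCdf n s m x = 0) ∧ ∀ x, 1 ≤ x → approxCdf n s m x = 1 := by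
  induction m with
  | zero => exact ⟨fun x => unitClamp_of_nonpos, fun x => unitClamp_of_one_le⟩
  | succ m ih =>
    refine ⟨fun x hx => Finset.sum_eq_zero fun k hk => ?_, fun x hx => ?_⟩
    · rw [ih.2, sub_self, mul_zero]
      refine not_lt.1 fun h => ?_
      have := (gaussLin_lt_one_iff (Finset.mem_Icc.1 hk).1 x).1 h
      have : (0 : ℝ) < 1 / ((k : ℝ) + 1) := by positivity
      linarith
    · rw [← hs, approxCdf]
      refine Finset.sum_congr rfl fun k hk => ?_
      rw [ih.1, sub_zero, mul_one]
      refine not_lt.1 fun h => ?_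
      have h1 := (gaussLin_pos_iff (Finset.mem_Icc.1 hk).1 x).1 h
      have h2 : (1 : ℝ) / k ≤ 1 := by
        rw [div_le_one (by have := (Finset.mem_Icc.1 hk).1; positivity)]
        exact_mod_cast (Finset.mem_Icc.1 hk).1
      linarith

/-! ### Distance to Lebesgue measure -/

theorem gaussLin_mem_Ioo_unique {j k : ℕ} (hj : 1 ≤ j) (hk : 1 ≤ k) {x : ℝ}
    (hxj : gaussLin j x ∈ Ioo (0 : ℝ) 1) (hxk : gaussLin k x ∈ Ioo (0 : ℝ) 1) : j = k := by
  have key : ∀ {a b : ℕ}, 1 ≤ a → 1 ≤ b → gaussLin a x ∈ Ioo (0 : ℝ) 1 →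
      gaussLin b x ∈ Ioo (0 : ℝ) 1 → a ≤ b := by
    intro a b ha hb hxa hxb
    by_contra! h
    have h1 := (gaussLin_pos_iff ha x).1 hxa.1
    have h2 := (gaussLin_lt_one_iff hb x).1 hxb.2
    have h3 : (b : ℝ) + 1 ≤ a := by exact_mod_cast h
    have h4 := one_div_le_one_div_of_le (by positivity) h3
    linarith
  exact le_antisymm (key hj hk hxj hxk) (key hk hj hxk hxj)

open Classical in
/-- The weight of the first-level cylinder whose interior contains `x`. -/
def cylinderWeight (n : ℕ) (s x : ℝ) : ℝ :=
  ∑ k ∈ Finset.Icc 1 n, if gaussLin k x ∈ Ioo (0 : ℝ) 1 then gaussRatio k ^ s else 0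

theorem cylinderWeight_le {n : ℕ} {s x M : ℝ} (hM : 0 ≤ M)
    (h : ∀ k ∈ Finset.Icc 1 n, gaussLin k x ∈ Ioo (0 : ℝ) 1 → gaussRatio k ^ s ≤ M) :
    cylinderWeight n s x ≤ M := by
  unfold cylinderWeight
  by_cases hx : ∃ k ∈ Finset.Icc 1 n, gaussLin k x ∈ Ioo (0 : ℝ) 1
  · obtain ⟨k, hk, hxk⟩ := hx
    rw [Finset.sum_eq_single_of_mem k hk, if_pos hxk]
    · exact h k hk hxk
    · intro j hj hjk
      exact if_neg fun hxj =>
        hjk (gaussLin_mem_Ioo_unique (Finset.mem_Icc.1 hj).1 (Finset.mem_Icc.1 hk).1 hxj hxk)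
  · push Not at hx
    rw [Finset.sum_eq_zero fun k hk => if_neg (hx k hk)]
    exact hM

/-- Both functions agree off `(0,1)`, so in the recursion only the cylinder whose interior contains
the point transmits an error. -/
theorem abs_approxCdf_sub_unitClamp_le_ite {n : ℕ} {s E : ℝ}
    (hs : ∑ k ∈ Finset.Icc 1 n, gaussRatio k ^ s = 1) {m : ℕ}
    (hE : ∀ x, |approxCdf n s m x - unitClamp x| ≤ E) (x : ℝ) :
    |approxCdf n s m x - unitClamp x| ≤ if x ∈ Ioo (0 : ℝ) 1 then E else 0 := by
  split_ifs with h
  · exact hE x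
  · rcases le_or_gt x 0 with h0 | h0
    · rw [(approxCdf_outside hs m).1 x h0, unitClamp_of_nonpos h0]; simp
    · have h1 : 1 ≤ x := not_lt.1 fun h1 => h ⟨h0, h1⟩
      rw [(approxCdf_outside hs m).2 x h1, unitClamp_of_one_le h1]; simp

theorem gaussRatio_le_rpow {k : ℕ} (hk : 1 ≤ k) {s : ℝ} (hs1 : s ≤ 1) :
    gaussRatio k ≤ gaussRatio k ^ s := by
  conv_lhs => rw [← Real.rpow_one (gaussRatio k)]
  exact Real.rpow_le_rpow_of_exponent_ge (gaussRatio_pos hk)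
    ((gaussRatio_le_half hk).trans (by norm_num)) hs1

theorem unitClamp_mem (x : ℝ) : unitClamp x ∈ Icc (0 : ℝ) 1 :=
  ⟨le_max_left _ _, max_le zero_le_one (min_le_left _ _)⟩

/-- One step of the recursion moves the identity by at most `1 / (n + 1)`. -/
theorem abs_sum_sub_unitClamp_le {n : ℕ} {s : ℝ} (hs1 : s ≤ 1)
    (hs : ∑ k ∈ Finset.Icc 1 n, gaussRatio k ^ s = 1) {x : ℝ} (hx0 : 0 ≤ x) :
    |∑ k ∈ Finset.Icc 1 n, gaussRatio k ^ s * (1 - unitClamp (gaussLin k x)) - unitClamp x|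
      ≤ 1 / ((n : ℝ) + 1) := by
  have hsplit : ∑ k ∈ Finset.Icc 1 n, gaussRatio k ^ s * (1 - unitClamp (gaussLin k x))
      = ∑ k ∈ Finset.Icc 1 n, gaussRatio k * (1 - unitClamp (gaussLin k x))
        + ∑ k ∈ Finset.Icc 1 n,
          (gaussRatio k ^ s - gaussRatio k) * (1 - unitClamp (gaussLin k x)) := by
    rw [← Finset.sum_add_distrib]
    exact Finset.sum_congr rfl fun k _ => by ring
  have hd : ∑ k ∈ Finset.Icc 1 n, (gaussRatio k ^ s - gaussRatio k) = 1 / ((n : ℝ) + 1) := by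
    rw [Finset.sum_sub_distrib, hs, sum_gaussRatio]; ring
  have h0 : 0 ≤ ∑ k ∈ Finset.Icc 1 n,
      (gaussRatio k ^ s - gaussRatio k) * (1 - unitClamp (gaussLin k x)) :=
    Finset.sum_nonneg fun k hk => mul_nonneg
      (sub_nonneg.2 (gaussRatio_le_rpow (Finset.mem_Icc.1 hk).1 hs1))
      (sub_nonneg.2 (unitClamp_mem _).2)
  have h1 : ∑ k ∈ Finset.Icc 1 n,
      (gaussRatio k ^ s - gaussRatio k) * (1 - unitClamp (gaussLin k x)) ≤ 1 / ((n : ℝ) + 1) := by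
    rw [← hd]
    refine Finset.sum_le_sum fun k hk => mul_le_of_le_one_right
      (sub_nonneg.2 (gaussRatio_le_rpow (Finset.mem_Icc.1 hk).1 hs1)) ?_
    linarith [(unitClamp_mem (gaussLin k x)).1]
  have h2 : unitClamp x = min 1 x := max_eq_right (le_min zero_le_one hx0)
  have h3 : min (1 / ((n : ℝ) + 1)) x ≤ 1 / ((n : ℝ) + 1) := min_le_left _ _
  have h4 : 0 ≤ min (1 / ((n : ℝ) + 1)) x := le_min (by positivity) hx0
  rw [hsplit, sum_gaussRatio_mul_one_sub_unitClamp, h2, abs_le]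
  constructor <;> linarith

/-- A step multiplies the old error by at most the largest weight, `(1/2) ^ s ≤ 3/4`, and adds at
most `1 / (n + 1)`; the bound `4 / (n + 1)` is the fixed point of this recursion. -/
theorem abs_approxCdf_sub_unitClamp_le {n : ℕ} {s : ℝ} (hs0 : 0 ≤ s) (hs1 : s ≤ 1)
    (hs34 : (1 / 2 : ℝ) ^ s ≤ 3 / 4) (hs : ∑ k ∈ Finset.Icc 1 n, gaussRatio k ^ s = 1) (m : ℕ)
    (x : ℝ) : |approxCdf n s m x - unitClamp x| ≤ 4 / ((n : ℝ) + 1) := by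
  induction m generalizing x with
  | zero => simp only [approxCdf, sub_self, abs_zero]; positivity
  | succ m ih =>
    rcases le_or_gt 0 x with hx | hx
    · have hdiff : |approxCdf n s (m + 1) x
          - ∑ k ∈ Finset.Icc 1 n, gaussRatio k ^ s * (1 - unitClamp (gaussLin k x))|
          ≤ 4 / ((n : ℝ) + 1) * cylinderWeight n s x := by
        rw [approxCdf, ← Finset.sum_sub_distrib, cylinderWeight, Finset.mul_sum]
        refine (Finset.abs_sum_le_sum_abs _ _).trans (Finset.sum_le_sum fun k hk => ?_)
        have hp := Real.rpow_pos_of_pos (gaussRatio_pos (Finset.mem_Icc.1 hk).1) s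
        have := abs_approxCdf_sub_unitClamp_le_ite hs ih (gaussLin k x)
        rw [← mul_sub, abs_mul, abs_of_pos hp, sub_sub_sub_cancel_left, abs_sub_comm]
        refine (mul_le_mul_of_nonneg_left this hp.le).trans (le_of_eq ?_)
        split_ifs <;> ring
      have hw : cylinderWeight n s x ≤ 3 / 4 := by
        refine cylinderWeight_le (by norm_num) fun k hk _ => ?_
        exact (Real.rpow_le_rpow (gaussRatio_pos (Finset.mem_Icc.1 hk).1).le
          (gaussRatio_le_half (Finset.mem_Icc.1 hk).1) hs0).trans hs34
      have h1 := abs_sum_sub_unitClamp_le hs1 hs hx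
      have h2 := abs_sub_le (approxCdf n s (m + 1) x)
        (∑ k ∈ Finset.Icc 1 n, gaussRatio k ^ s * (1 - unitClamp (gaussLin k x))) (unitClamp x)
      have h3 : 4 / ((n : ℝ) + 1) * cylinderWeight n s x ≤ 4 / ((n : ℝ) + 1) * (3 / 4) := by
        gcongr
      have h4 : 4 / ((n : ℝ) + 1) * (3 / 4) + 1 / ((n : ℝ) + 1) = 4 / ((n : ℝ) + 1) := by ring
      linarith
    · rw [(approxCdf_outside hs (m + 1)).1 x hx.le, unitClamp_of_nonpos hx.le]
      simp only [sub_self, abs_zero]; positivity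

/-! ### Mass of balls centered in the limit set -/

theorem gaussRatio_rpow_le_mul {n k : ℕ} (hk : 1 ≤ k) (hkn : k ≤ n) {s : ℝ} (hs1 : s ≤ 1) :
    gaussRatio k ^ s ≤ gaussRatio n ^ (s - 1) * gaussRatio k := by
  have hp := gaussRatio_pos hk
  have h := Real.rpow_le_rpow_of_nonpos (gaussRatio_pos (hk.trans hkn)) (gaussRatio_anti hk hkn)
    (sub_nonpos.2 hs1)
  calc gaussRatio k ^ s = gaussRatio k ^ (s - 1) * gaussRatio k := by
        rw [← Real.rpow_add_one hp.ne']; simp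
    _ ≤ _ := by gcongr

/-- An interval of length at least that of the cylinder of its left end point has almost the
expected mass. -/
theorem approxCdf_sub_ge_of_ratio_le {n : ℕ} {s : ℝ} (hs0 : 0 ≤ s) (hs1 : s ≤ 1)
    (hs34 : (1 / 2 : ℝ) ^ s ≤ 3 / 4) (hs : ∑ k ∈ Finset.Icc 1 n, gaussRatio k ^ s = 1) (m : ℕ)
    {k : ℕ} (hk : 1 ≤ k) (hkn : k ≤ n) {x r : ℝ}
    (hx : x ∈ Icc (1 / ((k : ℝ) + 1)) (1 / k)) (hr : gaussRatio k ≤ r) (hxr : x + r ≤ 1) :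
    r * (1 - 16 / ((n : ℝ) + 1) * gaussRatio n ^ (s - 1))
      ≤ approxCdf n s (m + 1) (x + r) - approxCdf n s (m + 1) x := by
  set E : ℝ := 4 / ((n : ℝ) + 1) with hE
  set κ : ℝ := gaussRatio n ^ (s - 1) with hκ
  have hκ0 : 0 < κ := Real.rpow_pos_of_pos (gaussRatio_pos (hk.trans hkn)) _
  have hr0 : 0 < r := (gaussRatio_pos hk).trans_le hr
  have hE0 : 0 ≤ E := by positivity
  have hwa : cylinderWeight n s x ≤ κ * r := by
    refine cylinderWeight_le (by positivity) fun j hj hxj => ?_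
    obtain ⟨hj1, hjn⟩ := Finset.mem_Icc.1 hj
    refine (gaussRatio_rpow_le_mul hj1 hjn hs1).trans ?_
    have h1 := (gaussLin_pos_iff hj1 x).1 hxj.1
    have hkj : k ≤ j → gaussRatio j ≤ r := fun h => (gaussRatio_anti hk h).trans hr
    have : k ≤ j := by
      by_contra! h
      have h2 := (gaussLin_lt_one_iff hj1 x).1 hxj.2
      have h3 : (j : ℝ) + 1 ≤ k := by exact_mod_cast h
      have h4 := one_div_le_one_div_of_le (by positivity) h3
      linarith [hx.2]
    have := hkj this
    gcongr
  -- Neighboring ratios differ by a factor at most `3`. If `j + 1 < k`, the whole cylinder `j + 1`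
  -- lies in `[x, x + r]`, so `gaussRatio (j + 1) ≤ r`.
  have hwb : cylinderWeight n s (x + r) ≤ κ * (3 * r) := by
    refine cylinderWeight_le (by positivity) fun j hj hxj => ?_
    obtain ⟨hj1, hjn⟩ := Finset.mem_Icc.1 hj
    refine (gaussRatio_rpow_le_mul hj1 hjn hs1).trans ?_
    have : gaussRatio j ≤ 3 * r := by
      rcases le_or_gt k (j + 1) with h | h
      · linarith [gaussRatio_le_three_mul hj1, gaussRatio_anti hk h]
      · have h2 := (gaussLin_lt_one_iff hj1 (x + r)).1 hxj.2
        have h3 : (j : ℝ) + 1 + 1 ≤ k := by exact_mod_cast h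
        have h4 := one_div_le_one_div_of_le (by positivity) h3
        have h5 := gaussRatio_eq (k := j + 1) (by omega)
        push_cast at h5
        linarith [gaussRatio_le_three_mul hj1, hx.2]
    gcongr
  have hx0 : 1 / ((n : ℝ) + 1) ≤ x :=
    (one_div_le_one_div_of_le (by positivity) (by gcongr)).trans hx.1
  -- The interval `[x, x + r]` lies in `[1/(n+1), 1]`, which the first-level cylinders tile, so no
  -- length is lost.
  have hlen : ∑ j ∈ Finset.Icc 1 n,
      gaussRatio j * (unitClamp (gaussLin j x) - unitClamp (gaussLin j (x + r))) = r := by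
    have h1 := sum_gaussRatio_mul_one_sub_unitClamp n x
    have h2 := sum_gaussRatio_mul_one_sub_unitClamp n (x + r)
    rw [min_eq_right (by linarith), min_eq_left (by linarith)] at h1 h2
    have : ∑ j ∈ Finset.Icc 1 n,
        gaussRatio j * (unitClamp (gaussLin j x) - unitClamp (gaussLin j (x + r)))
        = ∑ j ∈ Finset.Icc 1 n, gaussRatio j * (1 - unitClamp (gaussLin j (x + r)))
          - ∑ j ∈ Finset.Icc 1 n, gaussRatio j * (1 - unitClamp (gaussLin j x)) := by
      rw [← Finset.sum_sub_distrib]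
      exact Finset.sum_congr rfl fun k _ => by ring
    rw [this, h1, h2]; ring
  have hclose := abs_approxCdf_sub_unitClamp_le hs0 hs1 hs34 hs m
  rw [← hE] at hclose
  -- Raising the weights from `gaussRatio j` to `gaussRatio j ^ s` only helps; errors come only from
  -- the two cylinders containing the end points.
  have hmain : r - E * cylinderWeight n s x - E * cylinderWeight n s (x + r)
      ≤ approxCdf n s (m + 1) (x + r) - approxCdf n s (m + 1) x := by
    nth_rewrite 1 [← hlen]
    rw [approxCdf, approxCdf, cylinderWeight, cylinderWeight, Finset.mul_sum,
      Finset.mul_sum, ← Finset.sum_sub_distrib, ← Finset.sum_sub_distrib,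
      ← Finset.sum_sub_distrib]
    refine Finset.sum_le_sum fun j hj => ?_
    have hj1 := (Finset.mem_Icc.1 hj).1
    have hp := Real.rpow_pos_of_pos (gaussRatio_pos hj1) s
    have ha := (abs_le.1 (abs_approxCdf_sub_unitClamp_le_ite hs hclose (gaussLin j x))).1
    have hb := (abs_le.1 (abs_approxCdf_sub_unitClamp_le_ite hs hclose (gaussLin j (x + r)))).2
    have hmono : 0 ≤ unitClamp (gaussLin j x) - unitClamp (gaussLin j (x + r)) :=
      sub_nonneg.2 (unitClamp_monotone (gaussLin_antitone j (by linarith)))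
    have h1 := mul_le_mul_of_nonneg_right (gaussRatio_le_rpow hj1 hs1) hmono
    have ha' := mul_le_mul_of_nonneg_left ha hp.le
    have hb' := mul_le_mul_of_nonneg_left hb hp.le
    split_ifs at ha' hb' ⊢ <;> linarith
  have h1 := mul_le_mul_of_nonneg_left hwa hE0
  have h2 := mul_le_mul_of_nonneg_left hwb hE0
  have h3 : 16 / ((n : ℝ) + 1) = 4 * E := by rw [hE]; ring
  rw [h3]
  nlinarith

/-- The finite-level approximations of the limit set, starting with `[0,1]`. -/
def levelSet (n l : ℕ) : Set ℝ :=
  ⋃ (w : List ℕ) (_ : w.length = l ∧ ∀ k ∈ w, 1 ≤ k ∧ k ≤ n), wordMap w '' Icc (0 : ℝ) 1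

theorem exists_of_mem_levelSet_succ {n l : ℕ} {x : ℝ} (hx : x ∈ levelSet n (l + 1)) :
    ∃ k, 1 ≤ k ∧ k ≤ n ∧ ∃ y ∈ levelSet n l, x = gaussInv k y := by
  simp only [levelSet, mem_iUnion, exists_prop] at hx
  obtain ⟨w, ⟨hl, hw⟩, y, hy, rfl⟩ := hx
  cases w with
  | nil => simp at hl
  | cons k w =>
    refine ⟨k, (hw k (by simp)).1, (hw k (by simp)).2, wordMap w y, ?_, rfl⟩
    simp only [levelSet, mem_iUnion, exists_prop]
    exact ⟨w, ⟨by simpa using hl, fun j hj => hw j (by simp [hj])⟩, y, hy, rfl⟩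

theorem levelSet_subset_Icc (n l : ℕ) : levelSet n l ⊆ Icc 0 1 := by
  induction l with
  | zero =>
    intro x hx
    simp only [levelSet, mem_iUnion, exists_prop] at hx
    obtain ⟨w, ⟨hl, -⟩, y, hy, rfl⟩ := hx
    rw [List.length_eq_zero_iff] at hl
    subst hl
    exact hy
  | succ l ih =>
    intro x hx
    obtain ⟨k, hk, -, y, hy, rfl⟩ := exists_of_mem_levelSet_succ hx
    have h := gaussInv_mem_Icc hk (ih hy)
    have h1 : (1 : ℝ) / k ≤ 1 := by
      rw [div_le_one (by positivity)]; exact_mod_cast hk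
    exact ⟨le_trans (by positivity) h.1, h.2.trans h1⟩

theorem limitSet_subset_levelSet {n l : ℕ} (hl : 1 ≤ l) : limitSet n ⊆ levelSet n l :=
  fun _ hx => mem_iInter₂.1 hx l hl

/-- Lower bound for the mass of balls centred at the limit set. -/
theorem approxCdf_ball_ge {n : ℕ} {s : ℝ} (hn : 1 ≤ n) (hs0 : 0 ≤ s) (hs1 : s ≤ 1)
    (hs34 : (1 / 2 : ℝ) ^ s ≤ 3 / 4) (hs : ∑ k ∈ Finset.Icc 1 n, gaussRatio k ^ s = 1)
    {θ : ℝ} (hθ0 : 0 ≤ θ)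
    (hθ : θ * gaussRatio n ^ (s - 1) ≤ 1 - 16 / ((n : ℝ) + 1) * gaussRatio n ^ (s - 1))
    (m : ℕ) {x r : ℝ} (hx : x ∈ levelSet n m) (hrm : (1 / 2 : ℝ) ^ m ≤ r) (hr : r ≤ 1) :
    θ * r ^ s ≤ approxCdf n s m (x + r) - approxCdf n s m (x - r) := by
  have hκ1 : 1 ≤ gaussRatio n ^ (s - 1) := Real.one_le_rpow_of_pos_of_le_one_of_nonpos
    (gaussRatio_pos hn) ((gaussRatio_le_half hn).trans (by norm_num)) (by linarith)
  -- At scales above the smallest ratio, `ρ ^ (s - 1) ≤ gaussRatio n ^ (s - 1)` turns a linear mass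
  -- bound into one of order `s`.
  have hrpow : ∀ ρ, gaussRatio n ≤ ρ → θ * ρ ^ s
      ≤ ρ * (1 - 16 / ((n : ℝ) + 1) * gaussRatio n ^ (s - 1)) := by
    intro ρ hρ
    have hρ0 := (gaussRatio_pos hn).trans_le hρ
    have h := Real.rpow_le_rpow_of_nonpos (gaussRatio_pos hn) hρ (sub_nonpos.2 hs1)
    calc θ * ρ ^ s = θ * ρ ^ (s - 1) * ρ := by
          rw [mul_assoc, ← Real.rpow_add_one hρ0.ne']; simp
      _ ≤ θ * gaussRatio n ^ (s - 1) * ρ := by gcongr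
      _ ≤ (1 - 16 / ((n : ℝ) + 1) * gaussRatio n ^ (s - 1)) * ρ := by gcongr
      _ = _ := by ring
  have hlarge : ∀ m x r, x ∈ Icc (0 : ℝ) 1 → 1 / 2 ≤ r → r ≤ 1 →
      θ * r ^ s ≤ approxCdf n s m (x + r) - approxCdf n s m (x - r) := by
    intro m x r hx hr2 hr1
    refine (hrpow r ((gaussRatio_le_half hn).trans hr2)).trans ?_
    have ha := (abs_le.1 (abs_approxCdf_sub_unitClamp_le hs0 hs1 hs34 hs m (x + r))).1
    have hb := (abs_le.1 (abs_approxCdf_sub_unitClamp_le hs0 hs1 hs34 hs m (x - r))).2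
    have hc : r ≤ unitClamp (x + r) - unitClamp (x - r) := by
      have h0 : 0 ≤ x + r := by linarith [hx.1]
      have h1 : x - r ≤ 1 := by linarith [hx.2]
      unfold unitClamp
      rw [min_eq_right h1, max_eq_right (le_min zero_le_one h0)]
      rcases min_cases 1 (x + r) with h | h <;> rcases max_cases 0 (x - r) with h' | h' <;>
        linarith [hx.1, hx.2]
    have hd : 8 / ((n : ℝ) + 1) ≤ r * (16 / ((n : ℝ) + 1) * gaussRatio n ^ (s - 1)) := by
      calc 8 / ((n : ℝ) + 1) = 1 / 2 * (16 / ((n : ℝ) + 1) * 1) := by ring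
        _ ≤ _ := by gcongr
    have he : 8 / ((n : ℝ) + 1) = 4 / ((n : ℝ) + 1) + 4 / ((n : ℝ) + 1) := by ring
    linarith
  induction m generalizing x r with
  | zero =>
    exact hlarge 0 x r (levelSet_subset_Icc _ _ hx) (le_trans (by norm_num) hrm) hr
  | succ m ih =>
    have hx01 := levelSet_subset_Icc _ _ hx
    rcases le_or_gt (1 / 2) r with h2 | h2
    · exact hlarge _ x r hx01 h2 hr
    obtain ⟨k, hk, hkn, y, hy, rfl⟩ := exists_of_mem_levelSet_succ hx
    have hr0 : 0 < r := lt_of_lt_of_le (by positivity) hrm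
    have hc := gaussRatio_pos hk
    -- Below the cylinder length, magnify by `gaussLin k`: the radius at least doubles, which pays
    -- for the lost level. Otherwise use the right half of the ball.
    rcases lt_or_ge r (gaussRatio k) with hrk | hrk
    · have hc2 := gaussRatio_le_half hk
      have hr' : (1 / 2 : ℝ) ^ m ≤ r / gaussRatio k := by
        rw [le_div_iff₀ hc]
        rw [pow_succ] at hrm
        exact le_trans (by gcongr) hrm
      have key := ih hy hr' ((div_le_one hc).2 hrk.le)
      have e1 : gaussLin k (gaussInv k y + r) = y - r / gaussRatio k := by
        rw [gaussLin_eq hk, gaussInv_eq hk]; field_simp; ring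
      have e2 : gaussLin k (gaussInv k y - r) = y + r / gaussRatio k := by
        rw [gaussLin_eq hk, gaussInv_eq hk]; field_simp; ring
      have hcs := Real.rpow_pos_of_pos hc s
      rw [approxCdf, approxCdf, ← Finset.sum_sub_distrib]
      refine le_trans ?_ (Finset.single_le_sum (f := fun j =>
        gaussRatio j ^ s * (1 - approxCdf n s m (gaussLin j (gaussInv k y + r)))
        - gaussRatio j ^ s * (1 - approxCdf n s m (gaussLin j (gaussInv k y - r))))
        (fun j hj => ?_) (Finset.mem_Icc.2 ⟨hk, hkn⟩))
      · simp only [e1, e2]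
        rw [Real.div_rpow hr0.le hc.le] at key
        have := mul_le_mul_of_nonneg_left key hcs.le
        have h3 : gaussRatio k ^ s * (θ * (r ^ s / gaussRatio k ^ s)) = θ * r ^ s := by
          field_simp
        linarith
      · have hcj := Real.rpow_pos_of_pos (gaussRatio_pos (Finset.mem_Icc.1 hj).1) s
        have hm := approxCdf_monotone n s m (gaussLin_antitone j
          (show gaussInv k y - r ≤ gaussInv k y + r by linarith))
        rw [← mul_sub]
        exact mul_nonneg hcj.le (by linarith)
    · have hI := gaussInv_mem_Icc hk (levelSet_subset_Icc _ _ hy)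
      -- Here `r < 1/2 = gaussRatio 1` excludes `k = 1`, so the center is at most `1/2` and `x + r ≤
      -- 1`.
      have hk2 : 2 ≤ k := by
        by_contra! h
        obtain rfl : k = 1 := by omega
        norm_num [gaussRatio] at hrk
        linarith
      have hhalf : (1 : ℝ) / k ≤ 1 / 2 :=
        one_div_le_one_div_of_le (by norm_num) (by exact_mod_cast hk2)
      have h1 := approxCdf_sub_ge_of_ratio_le hs0 hs1 hs34 hs m hk hkn hI hrk
        (by linarith [hI.2])
      have h3 := approxCdf_monotone n s (m + 1)
        (show gaussInv k y - r ≤ gaussInv k y by linarith)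
      linarith [hrpow r ((gaussRatio_anti hk hkn).trans hrk)]

/-! ### Words and cylinders -/

/-- The contraction ratio of `wordMap w`. -/
def wordRatio (w : List ℕ) : ℝ := (w.map gaussRatio).prod

theorem wordRatio_cons (k : ℕ) (w : List ℕ) :
    wordRatio (k :: w) = gaussRatio k * wordRatio w := by
  simp [wordRatio]

theorem wordRatio_append (v w : List ℕ) : wordRatio (v ++ w) = wordRatio v * wordRatio w := by
  simp [wordRatio]

theorem wordRatio_pos {w : List ℕ} (hw : ∀ k ∈ w, 1 ≤ k) : 0 < wordRatio w := by
  refine List.prod_pos fun a ha => ?_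
  obtain ⟨k, hk, rfl⟩ := List.mem_map.1 ha
  exact gaussRatio_pos (hw k hk)

theorem wordRatio_le {w : List ℕ} (hw : ∀ k ∈ w, 1 ≤ k) : wordRatio w ≤ (1 / 2) ^ w.length := by
  induction w with
  | nil => simp [wordRatio]
  | cons k w ih =>
    rw [wordRatio_cons, List.length_cons, pow_succ']
    have hk := hw k (by simp)
    have hw' : ∀ j ∈ w, 1 ≤ j := fun j hj => hw j (by simp [hj])
    exact mul_le_mul (gaussRatio_le_half hk) (ih hw') (wordRatio_pos hw').le (by norm_num)

theorem wordMap_append (v w : List ℕ) (y : ℝ) : wordMap (v ++ w) y = wordMap v (wordMap w y) := by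
  induction v with
  | nil => rfl
  | cons k v ih => exact congrArg (gaussInv k) ih

theorem wordMap_affine {w : List ℕ} (hw : ∀ k ∈ w, 1 ≤ k) :
    ∃ σ : ℝ, |σ| = 1 ∧ ∀ x y, wordMap w x - wordMap w y = σ * wordRatio w * (x - y) := by
  induction w with
  | nil => exact ⟨1, by simp, fun x y => by simp [wordRatio, wordMap]⟩
  | cons k w ih =>
    obtain ⟨σ, hσ, h⟩ := ih fun j hj => hw j (by simp [hj])
    refine ⟨-σ, by simpa using hσ, fun x y => ?_⟩
    simp only [wordMap, Function.comp_apply, gaussInv_eq (hw k (by simp)), wordRatio_cons]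
    linear_combination -gaussRatio k * h x y

theorem gaussInv_mem_Ioo {k : ℕ} (hk : 1 ≤ k) {y : ℝ} (hy : y ∈ Ioo (0 : ℝ) 1) :
    gaussInv k y ∈ Ioo (0 : ℝ) 1 := by
  have h := gaussInv_mem_Icc hk (Ioo_subset_Icc_self hy)
  have hr := mul_pos (gaussRatio_pos hk) hy.1
  have h1 : (1 : ℝ) / k ≤ 1 := by
    rw [div_le_one (by positivity)]; exact_mod_cast hk
  refine ⟨lt_of_lt_of_le (by positivity) h.1, ?_⟩
  rw [gaussInv_eq hk]
  linarith

theorem wordMap_mem_Ioo {w : List ℕ} (hw : ∀ k ∈ w, 1 ≤ k) {y : ℝ} (hy : y ∈ Ioo (0 : ℝ) 1) :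
    wordMap w y ∈ Ioo (0 : ℝ) 1 := by
  induction w with
  | nil => exact hy
  | cons k w ih => exact gaussInv_mem_Ioo (hw k (by simp)) (ih fun j hj => hw j (by simp [hj]))

/-- The open cylinders of a given level are pairwise disjoint. -/
theorem eq_of_wordMap_eq {v w : List ℕ} (hv : ∀ k ∈ v, 1 ≤ k) (hw : ∀ k ∈ w, 1 ≤ k)
    (hl : v.length = w.length) {x y : ℝ} (hx : x ∈ Ioo (0 : ℝ) 1) (hy : y ∈ Ioo (0 : ℝ) 1)
    (h : wordMap v x = wordMap w y) : v = w := by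
  induction v generalizing w with
  | nil => exact (List.length_eq_zero_iff.1 hl.symm).symm
  | cons j v ih =>
    cases w with
    | nil => simp at hl
    | cons k w =>
      have hj := hv j (by simp)
      have hk := hw k (by simp)
      have hv' : ∀ i ∈ v, 1 ≤ i := fun i hi => hv i (by simp [hi])
      have hw' : ∀ i ∈ w, 1 ≤ i := fun i hi => hw i (by simp [hi])
      have h' : gaussInv j (wordMap v x) = gaussInv k (wordMap w y) := h
      have hjk : j = k := by
        refine gaussLin_mem_Ioo_unique hj hk (x := gaussInv j (wordMap v x)) ?_ ?_
        · rw [gaussLin_gaussInv hj]; exact wordMap_mem_Ioo hv' hx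
        · rw [h', gaussLin_gaussInv hk]; exact wordMap_mem_Ioo hw' hy
      subst hjk
      have h2 := congrArg (gaussLin j) h'
      rw [gaussLin_gaussInv hj, gaussLin_gaussInv hj] at h2
      rw [ih hv' hw' (by simpa using hl) h2]

/-- The distance from `2/3` to the boundary of `[0,1]` is `1/3`, and `wordMap w` is a similarity. -/
theorem mem_wordMap_image_of_abs_sub_lt {w : List ℕ} (hw : ∀ k ∈ w, 1 ≤ k) {z : ℝ}
    (hz : |z - wordMap w (2 / 3)| < wordRatio w / 3) : z ∈ wordMap w '' Ioo (0 : ℝ) 1 := by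
  obtain ⟨σ, hσ, h⟩ := wordMap_affine hw
  have hρ := wordRatio_pos hw
  have hσ2 : σ * σ = 1 := by rw [← abs_mul_abs_self, hσ, one_mul]
  set d : ℝ := σ * (z - wordMap w (2 / 3)) / wordRatio w with hd
  have hd1 : |d| < 1 / 3 := by
    rw [hd, abs_div, abs_mul, hσ, one_mul, abs_of_pos hρ, div_lt_iff₀ hρ]
    linarith
  rw [abs_lt] at hd1
  refine ⟨2 / 3 + d, ⟨by linarith, by linarith⟩, ?_⟩
  have h1 := h (2 / 3 + d) (2 / 3)
  have h2 : wordRatio w * d = σ * (z - wordMap w (2 / 3)) := by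
    rw [hd, mul_div_cancel₀ _ hρ.ne']
  linear_combination h1 + σ * h2 + (z - wordMap w (2 / 3)) * hσ2

/-! ### Compactness and invariance of the limit set -/

theorem levelSet_succ (n l : ℕ) :
    levelSet n (l + 1) = ⋃ k ∈ Finset.Icc 1 n, gaussInv k '' levelSet n l := by
  ext x
  simp only [mem_iUnion, exists_prop]
  constructor
  · intro hx
    obtain ⟨k, hk, hkn, y, hy, rfl⟩ := exists_of_mem_levelSet_succ hx
    exact ⟨k, Finset.mem_Icc.2 ⟨hk, hkn⟩, y, hy, rfl⟩
  · rintro ⟨k, hk, y, hy, rfl⟩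
    simp only [levelSet, mem_iUnion, exists_prop] at hy ⊢
    obtain ⟨w, ⟨hl, hw⟩, z, hz, rfl⟩ := hy
    refine ⟨k :: w, ⟨by simp [hl], ?_⟩, z, hz, rfl⟩
    intro j hj
    rcases List.mem_cons.1 hj with rfl | hj
    · exact Finset.mem_Icc.1 hk
    · exact hw j hj

theorem levelSet_zero (n : ℕ) : levelSet n 0 = Icc 0 1 := by
  refine Subset.antisymm (levelSet_subset_Icc n 0) fun x hx => ?_
  simp only [levelSet, mem_iUnion, exists_prop]
  exact ⟨[], by simp, x, hx, rfl⟩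

theorem mem_limitSet_iff {n : ℕ} {x : ℝ} : x ∈ limitSet n ↔ ∀ l, x ∈ levelSet n l := by
  refine ⟨fun hx l => ?_, fun hx => mem_iInter₂.2 fun l _ => hx l⟩
  rcases Nat.eq_zero_or_pos l with rfl | hl
  · rw [levelSet_zero]
    exact levelSet_subset_Icc n 1 (limitSet_subset_levelSet le_rfl hx)
  · exact limitSet_subset_levelSet hl hx

theorem continuous_gaussInv (k : ℕ) : Continuous (gaussInv k) := by
  unfold gaussInv; fun_prop

theorem isCompact_levelSet (n l : ℕ) : IsCompact (levelSet n l) := by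
  induction l with
  | zero => rw [levelSet_zero]; exact isCompact_Icc
  | succ l ih =>
    rw [levelSet_succ]
    exact (Finset.Icc 1 n).isCompact_biUnion fun k _ => ih.image (continuous_gaussInv k)

theorem isClosed_limitSet (n : ℕ) : IsClosed (limitSet n) :=
  isClosed_iInter fun l => isClosed_iInter fun _ => (isCompact_levelSet n l).isClosed

theorem gaussInv_mem_limitSet {n k : ℕ} (hk : 1 ≤ k) (hkn : k ≤ n) {x : ℝ}
    (hx : x ∈ limitSet n) : gaussInv k x ∈ limitSet n := by
  refine mem_iInter₂.2 fun l hl => ?_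
  obtain ⟨l, rfl⟩ := Nat.exists_eq_add_of_le' hl
  change _ ∈ levelSet n (l + 1)
  rw [levelSet_succ]
  exact mem_biUnion (Finset.mem_Icc.2 ⟨hk, hkn⟩) ⟨x, mem_limitSet_iff.1 hx l, rfl⟩

theorem wordMap_mem_limitSet {n : ℕ} {w : List ℕ} (hw : ∀ k ∈ w, 1 ≤ k ∧ k ≤ n) {x : ℝ}
    (hx : x ∈ limitSet n) : wordMap w x ∈ limitSet n := by
  induction w with
  | nil => exact hx
  | cons k w ih =>
    exact gaussInv_mem_limitSet (hw k (by simp)).1 (hw k (by simp)).2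
      (ih fun j hj => hw j (by simp [hj]))

/-- `2 / 3` is the fixed point of the first branch. -/
theorem two_thirds_mem_limitSet {n : ℕ} (hn : 1 ≤ n) : (2 / 3 : ℝ) ∈ limitSet n := by
  refine mem_limitSet_iff.2 fun l => ?_
  induction l with
  | zero => rw [levelSet_zero]; constructor <;> norm_num
  | succ l ih =>
    rw [levelSet_succ]
    exact mem_biUnion (Finset.mem_Icc.2 ⟨le_rfl, hn⟩) ⟨2 / 3, ih, by norm_num [gaussInv]⟩

/-! ### Infinite packing measure below the similarity dimension -/

/-- The word in the letters `1, …, n` given by a function. -/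
def funWord {n m : ℕ} (f : Fin m → Fin n) : List ℕ := List.ofFn fun i => (f i : ℕ) + 1

theorem funWord_mem {n m : ℕ} (f : Fin m → Fin n) : ∀ k ∈ funWord f, 1 ≤ k ∧ k ≤ n := by
  intro k hk
  obtain ⟨i, rfl⟩ := (List.mem_ofFn' _ _).1 hk
  exact ⟨Nat.le_add_left _ _, (f i).2⟩

theorem funWord_injective {n m : ℕ} : Function.Injective (funWord (n := n) (m := m)) := by
  intro f g h
  have := List.ofFn_injective h
  funext i
  exact Fin.ext (by simpa using congrFun this i)

theorem sum_wordRatio_rpow (n m : ℕ) (t : ℝ) :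
    ∑ f : Fin m → Fin n, wordRatio (funWord f) ^ t
      = (∑ k ∈ Finset.Icc 1 n, gaussRatio k ^ t) ^ m := by
  have h1 : ∑ k ∈ Finset.Icc 1 n, gaussRatio k ^ t = ∑ i : Fin n, gaussRatio (i + 1) ^ t := by
    rw [Fin.sum_univ_eq_sum_range (fun i => gaussRatio (i + 1) ^ t)]
    induction n with
    | zero => simp
    | succ n ih => rw [Finset.sum_Icc_succ_top (by omega), ih, Finset.sum_range_succ]
  rw [h1, Fintype.sum_pow]
  refine Finset.sum_congr rfl fun f _ => ?_
  rw [wordRatio, funWord, List.map_ofFn, List.prod_ofFn]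
  exact (Real.finsetProd_rpow _ _ (fun i _ => (gaussRatio_pos (Nat.succ_pos (f i))).le) t).symm

/-- Below the similarity dimension, a set that is dense in a portion of the limit set has infinite
packing premeasure. -/
theorem packingPremeasure_eq_top {n : ℕ} (hn : 1 ≤ n) {t : ℝ} (ht0 : 0 ≤ t)
    (ht : 1 < ∑ k ∈ Finset.Icc 1 n, gaussRatio k ^ t) {E : Set ℝ} {x₀ ρ : ℝ}
    (hx₀ : x₀ ∈ limitSet n) (hρ : 0 < ρ) (hE : limitSet n ∩ Metric.ball x₀ ρ ⊆ closure E) :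
    packingPremeasure t E = ⊤ := by
  obtain ⟨l, hl⟩ := exists_pow_lt_of_lt_one hρ (by norm_num : (1 / 2 : ℝ) < 1)
  have hxl := mem_limitSet_iff.1 hx₀ l
  simp only [levelSet, mem_iUnion, exists_prop] at hxl
  obtain ⟨w, ⟨rfl, hw⟩, y, hy, rfl⟩ := hxl
  have hw1 : ∀ k ∈ w, 1 ≤ k := fun k hk => (hw k hk).1
  have hρw := wordRatio_pos hw1
  simp only [packingPremeasure, iInf_eq_top]
  intro δ hδ
  have hlow : ∀ᶠ m : ℕ in atTop, ENNReal.ofReal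
      ((wordRatio w / 4) ^ t * (∑ k ∈ Finset.Icc 1 n, gaussRatio k ^ t) ^ m)
      ≤ packingSup t δ E := by
    obtain ⟨m₀, hm₀⟩ := exists_pow_lt_of_lt_one hδ (by norm_num : (1 / 2 : ℝ) < 1)
    filter_upwards [eventually_ge_atTop m₀] with m hm
    have hv : ∀ f : Fin m → Fin n, ∀ k ∈ w ++ funWord f, 1 ≤ k ∧ k ≤ n := fun f k hk =>
      (List.mem_append.1 hk).elim (hw k) (funWord_mem f k)
    have hv1 : ∀ f : Fin m → Fin n, ∀ k ∈ w ++ funWord f, 1 ≤ k := fun f k hk => (hv f k hk).1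
    have hpos : ∀ f : Fin m → Fin n, 0 < wordRatio (w ++ funWord f) := fun f =>
      wordRatio_pos (hv1 f)
    -- Each subcylinder of `w` contains a limit point well inside it, which density replaces by a
    -- point of `E`. The constants fit since `1/12 + 1/8 < 1/3`: the balls of radius `wordRatio / 8`
    -- stay in disjoint open cylinders.
    have hex : ∀ f : Fin m → Fin n, ∃ e ∈ E,
        |e - wordMap (w ++ funWord f) (2 / 3)| < wordRatio (w ++ funWord f) / 12 := by
      intro f
      have hq : wordMap (w ++ funWord f) (2 / 3) ∈ limitSet n ∩ Metric.ball (wordMap w y) ρ := by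
        refine ⟨wordMap_mem_limitSet (hv f) (two_thirds_mem_limitSet hn), ?_⟩
        obtain ⟨σ, hσ, h⟩ := wordMap_affine hw1
        have h23 : (2 / 3 : ℝ) ∈ Ioo (0 : ℝ) 1 := by constructor <;> norm_num
        have hu := wordMap_mem_Ioo (fun k hk => (funWord_mem f k hk).1) h23
        rw [Metric.mem_ball, Real.dist_eq, wordMap_append, h, abs_mul, abs_mul, hσ, one_mul,
          abs_of_pos hρw]
        have h1 : |wordMap (funWord f) (2 / 3) - y| ≤ 1 := by
          rw [abs_le]; constructor <;> linarith [hu.1, hu.2, hy.1, hy.2]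
        calc wordRatio w * |wordMap (funWord f) (2 / 3) - y| ≤ wordRatio w * 1 := by gcongr
          _ ≤ (1 / 2) ^ w.length := by rw [mul_one]; exact wordRatio_le hw1
          _ < ρ := hl
      obtain ⟨e, he, hd⟩ := Metric.mem_closure_iff.1 (hE hq) (wordRatio (w ++ funWord f) / 12)
        (by have := hpos f; positivity)
      exact ⟨e, he, by rwa [dist_comm, Real.dist_eq] at hd⟩
    choose e heE he using hex
    set B : (Fin m → Fin n) → ℝ × ℝ := fun f => (e f, wordRatio (w ++ funWord f) / 8) with hB
    have hsub : ∀ f, Metric.closedBall (B f).1 (B f).2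
        ⊆ wordMap (w ++ funWord f) '' Ioo (0 : ℝ) 1 := by
      intro f z hz
      rw [Metric.mem_closedBall, Real.dist_eq] at hz
      refine mem_wordMap_image_of_abs_sub_lt (hv1 f) ?_
      have h1 := abs_sub_le z (e f) (wordMap (w ++ funWord f) (2 / 3))
      have h2 := he f
      have h3 := hpos f
      simp only [hB] at hz
      linarith
    have hdisj : ∀ f g, f ≠ g → Disjoint (Metric.closedBall (B f).1 (B f).2)
        (Metric.closedBall (B g).1 (B g).2) := by
      intro f g hfg
      refine Set.disjoint_left.2 fun z hzf hzg => hfg ?_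
      obtain ⟨a, ha, rfl⟩ := hsub f hzf
      obtain ⟨b, hb, hab⟩ := hsub g hzg
      have h := eq_of_wordMap_eq (hv1 g) (hv1 f) (by simp [funWord]) hb ha hab
      exact (funWord_injective (List.append_cancel_left h)).symm
    have hBinj : Function.Injective B := by
      intro f g hfg
      by_contra h
      have h1 := hdisj f g h
      rw [hfg, disjoint_self, bot_eq_empty, Metric.closedBall_eq_empty] at h1
      have h2 := hpos g
      simp only [hB] at h1
      linarith
    have hpack : IsPacking δ E (range B) :=
      { countable := countable_range B
        center_mem := by rintro _ ⟨f, rfl⟩; exact heE f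
        radius_pos := by
          rintro _ ⟨f, rfl⟩
          have := hpos f
          simp only [hB]; positivity
        radius_le := by
          rintro _ ⟨f, rfl⟩
          have h1 := wordRatio_le (hv1 f)
          have h2 : (1 / 2 : ℝ) ^ (w ++ funWord f).length ≤ (1 / 2) ^ m₀ :=
            pow_le_pow_of_le_one (by norm_num) (by norm_num) (by simp [funWord]; omega)
          have h3 := hpos f
          simp only [hB]
          linarith
        disjoint := by
          rintro _ ⟨f, rfl⟩ _ ⟨g, rfl⟩ hfg
          exact hdisj f g fun h => hfg (by rw [h]) }
    refine le_trans (le_of_eq ?_) (le_iSup₂ (f := fun (R : Set (ℝ × ℝ)) (_ : IsPacking δ E R) =>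
      ∑' p : R, ENNReal.ofReal (Metric.diam (Metric.closedBall p.1.1 p.1.2)) ^ t)
      (range B) hpack)
    rw [tsum_range (f := fun p : ℝ × ℝ =>
      ENNReal.ofReal (Metric.diam (Metric.closedBall p.1 p.2)) ^ t) hBinj, tsum_fintype,
      ← sum_wordRatio_rpow, Finset.mul_sum, ENNReal.ofReal_sum_of_nonneg]
    · refine Finset.sum_congr rfl fun f _ => ?_
      have h3 := hpos f
      have h4 := wordRatio_pos fun k hk => (funWord_mem f k hk).1
      rw [Metric.diam_closedBall_eq _ (by simp only [hB]; positivity),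
        ENNReal.ofReal_rpow_of_nonneg (by simp only [hB]; positivity) ht0,
        ← Real.mul_rpow (by positivity) h4.le]
      congr 2
      simp only [hB, wordRatio_append]
      ring
    · intro f _
      have h4 := wordRatio_pos fun k hk => (funWord_mem f k hk).1
      positivity
  have hlim : Tendsto (fun m : ℕ => ENNReal.ofReal
      ((wordRatio w / 4) ^ t * (∑ k ∈ Finset.Icc 1 n, gaussRatio k ^ t) ^ m)) atTop (𝓝 ⊤) :=
    ENNReal.tendsto_ofReal_atTop.comp
      ((tendsto_pow_atTop_atTop_of_one_lt ht).const_mul_atTop (by positivity))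
  exact top_le_iff.1 (le_of_tendsto hlim hlow)

/-- Below the similarity dimension the packing measure of the limit set is infinite. -/
theorem packingMeasure_limitSet_eq_top {n : ℕ} (hn : 1 ≤ n) {t : ℝ} (ht0 : 0 ≤ t)
    (ht : 1 < ∑ k ∈ Finset.Icc 1 n, gaussRatio k ^ t) :
    packingMeasure t (limitSet n) = ⊤ := by
  simp only [packingMeasure, iInf_eq_top]
  intro A hA
  have : Nonempty (limitSet n) := ⟨⟨_, two_thirds_mem_limitSet hn⟩⟩
  have : CompleteSpace (limitSet n) := (isClosed_limitSet n).completeSpace_coe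
  -- Baire in the complete space `limitSet n`: the closure of some `A i` contains a portion of it.
  obtain ⟨i, ⟨x, hx⟩, hxi⟩ := nonempty_interior_of_iUnion_of_closed
    (f := fun i => ((↑) : limitSet n → ℝ) ⁻¹' closure (A i))
    (fun i => isClosed_closure.preimage continuous_subtype_val) (by
      refine eq_univ_of_forall fun x => ?_
      obtain ⟨i, hi⟩ := mem_iUnion.1 (hA x.2)
      exact mem_iUnion.2 ⟨i, subset_closure hi⟩)
  obtain ⟨ρ, hρ, hball⟩ := Metric.mem_nhds_iff.1 (mem_interior_iff_mem_nhds.1 hxi)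
  refine ENNReal.tsum_eq_top_of_eq_top ⟨i, packingPremeasure_eq_top hn ht0 ht hx hρ ?_⟩
  rintro z ⟨hz, hzx⟩
  exact hball (show (⟨z, hz⟩ : limitSet n) ∈ Metric.ball _ ρ from hzx)

/-! ### Upper bounds for packing sums -/

/-- A monotone function with values in `[0,1]` has total increment at most `1` over disjoint
intervals. -/
theorem sum_sub_le_one_of_pairwiseDisjoint {F : ℝ → ℝ} (hF : Monotone F)
    (h01 : ∀ x, F x ∈ Icc (0 : ℝ) 1) {ι : Type*} (T : Finset ι) (a b : ι → ℝ)
    (hab : ∀ i ∈ T, a i ≤ b i)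
    (hd : (T : Set ι).PairwiseDisjoint fun i => Icc (a i) (b i)) :
    ∑ i ∈ T, (F (b i) - F (a i)) ≤ 1 := by
  -- The increments are lengths of disjoint intervals in `[0,1]`, even if `F` is discontinuous.
  have hd' : (T : Set ι).PairwiseDisjoint fun i => Ioo (F (a i)) (F (b i)) := by
    intro i hi j hj hij
    have h := hd hi hj hij
    rcases lt_or_ge (b i) (a j) with h1 | h1
    · refine Set.disjoint_left.2 fun z hz hz' => ?_
      linarith [hF h1.le, hz.2, hz'.1]
    rcases lt_or_ge (b j) (a i) with h2 | h2
    · refine Set.disjoint_left.2 fun z hz hz' => ?_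
      linarith [hF h2.le, hz.1, hz'.2]
    have hz : max (a i) (a j) ∈ Icc (a i) (b i) := ⟨le_max_left _ _, max_le (hab i hi) h1⟩
    exact absurd ⟨le_max_right _ _, max_le h2 (hab j hj)⟩ (Set.disjoint_left.1 h hz)
  have h1 := MeasureTheory.measure_biUnion_finset (μ := MeasureTheory.volume) hd'
    fun i _ => measurableSet_Ioo
  have h2 : MeasureTheory.volume (⋃ i ∈ T, Ioo (F (a i)) (F (b i)))
      ≤ MeasureTheory.volume (Icc (0 : ℝ) 1) :=
    MeasureTheory.measure_mono (iUnion₂_subset fun i _ z hz =>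
      ⟨(h01 _).1.trans hz.1.le, hz.2.le.trans (h01 _).2⟩)
  rw [h1] at h2
  simp only [Real.volume_Ioo, Real.volume_Icc] at h2
  rw [← ENNReal.ofReal_sum_of_nonneg fun i hi => sub_nonneg.2 (hF (hab i hi)),
    ENNReal.ofReal_le_ofReal_iff (by norm_num)] at h2
  linarith

theorem packingSup_le_of_finset {h δ : ℝ} (hh : 0 ≤ h) {E : Set ℝ} {C : ℝ}
    (H : ∀ T : Finset (ℝ × ℝ), IsPacking δ E T → ∑ p ∈ T, (2 * p.2) ^ h ≤ C) :
    packingSup h δ E ≤ ENNReal.ofReal C := by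
  classical
  refine iSup₂_le fun R hR => ?_
  rw [ENNReal.tsum_eq_iSup_sum]
  refine iSup_le fun T => ?_
  have hT : (↑(T.map (Function.Embedding.subtype (· ∈ R))) : Set (ℝ × ℝ)) ⊆ R := by
    intro p hp
    obtain ⟨q, -, rfl⟩ := Finset.mem_map.1 (Finset.mem_coe.1 hp)
    exact q.2
  have hpos : ∀ p ∈ T, 0 < p.1.2 := fun p _ => hR.radius_pos _ p.2
  have h1 := H (T.map (Function.Embedding.subtype (· ∈ R)))
    { countable := hR.countable.mono hT
      center_mem := fun p hp => hR.center_mem p (hT hp)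
      radius_pos := fun p hp => hR.radius_pos p (hT hp)
      radius_le := fun p hp => hR.radius_le p (hT hp)
      disjoint := hR.disjoint.subset hT }
  rw [Finset.sum_map] at h1
  refine le_trans (le_of_eq ?_) (ENNReal.ofReal_le_ofReal h1)
  rw [ENNReal.ofReal_sum_of_nonneg fun p hp => by
    have := hpos p hp
    simp only [Function.Embedding.subtype_apply]; positivity]
  refine Finset.sum_congr rfl fun p hp => ?_
  have := hpos p hp
  rw [Metric.diam_closedBall_eq _ this.le, ENNReal.ofReal_rpow_of_nonneg (by positivity) hh]
  rfl

theorem approxCdf_mem_Icc {n : ℕ} {s : ℝ} (hs : ∑ k ∈ Finset.Icc 1 n, gaussRatio k ^ s = 1)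
    (m : ℕ) (x : ℝ) : approxCdf n s m x ∈ Icc (0 : ℝ) 1 := by
  have h := approxCdf_outside hs m
  constructor
  · rw [← h.1 (min x 0) (min_le_right _ _)]
    exact approxCdf_monotone n s m (min_le_left _ _)
  · rw [← h.2 (max x 1) (le_max_right _ _)]
    exact approxCdf_monotone n s m (le_max_left _ _)

theorem sum_packing_limitSet_le {n : ℕ} {s : ℝ} (hn : 1 ≤ n) (hs0 : 0 ≤ s) (hs1 : s ≤ 1)
    (hs34 : (1 / 2 : ℝ) ^ s ≤ 3 / 4) (hs : ∑ k ∈ Finset.Icc 1 n, gaussRatio k ^ s = 1)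
    {θ : ℝ} (hθ0 : 0 < θ)
    (hθ : θ * gaussRatio n ^ (s - 1) ≤ 1 - 16 / ((n : ℝ) + 1) * gaussRatio n ^ (s - 1))
    {δ : ℝ} (hδ : δ ≤ 1 / 2) (T : Finset (ℝ × ℝ)) (hT : IsPacking δ (limitSet n) T) :
    ∑ p ∈ T, (2 * p.2) ^ s ≤ 2 / θ := by
  -- Finiteness of the packing lets one level `m` resolve all its radii.
  have hev : ∀ᶠ m : ℕ in atTop, ∀ p ∈ T, (1 / 2 : ℝ) ^ m ≤ p.2 := by
    refine (Filter.eventually_all_finset T).2 fun p hp => ?_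
    exact (tendsto_pow_atTop_nhds_zero_of_lt_one (by norm_num) (by norm_num)).eventually_le_const
      (hT.radius_pos p hp)
  obtain ⟨m, hm⟩ := hev.exists
  have hsum := sum_sub_le_one_of_pairwiseDisjoint (approxCdf_monotone n s m)
    (approxCdf_mem_Icc hs m) T (fun p => p.1 - p.2) (fun p => p.1 + p.2)
    (fun p hp => by have := hT.radius_pos p hp; linarith) (by
      have := hT.disjoint
      simpa only [Real.closedBall_eq_Icc] using this)
  have hterm : ∀ p ∈ T, (2 * p.2) ^ s
      ≤ 2 / θ * (approxCdf n s m (p.1 + p.2) - approxCdf n s m (p.1 - p.2)) := by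
    intro p hp
    have hp0 := hT.radius_pos p hp
    have h1 := approxCdf_ball_ge hn hs0 hs1 hs34 hs hθ0.le hθ m
      (mem_limitSet_iff.1 (hT.center_mem p hp) m) (hm p hp)
      ((hT.radius_le p hp).trans (hδ.trans (by norm_num)))
    have h2 : (2 : ℝ) ^ s ≤ 2 := by
      conv_rhs => rw [← Real.rpow_one 2]
      exact Real.rpow_le_rpow_of_exponent_le (by norm_num) hs1
    have h3 := Real.rpow_nonneg hp0.le s
    rw [Real.mul_rpow (by norm_num) hp0.le]
    calc (2 : ℝ) ^ s * p.2 ^ s ≤ 2 * p.2 ^ s := by gcongr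
      _ = 2 / θ * (θ * p.2 ^ s) := by field_simp
      _ ≤ _ := by gcongr
  calc ∑ p ∈ T, (2 * p.2) ^ s
      ≤ ∑ p ∈ T, 2 / θ * (approxCdf n s m (p.1 + p.2) - approxCdf n s m (p.1 - p.2)) :=
        Finset.sum_le_sum hterm
    _ = 2 / θ * ∑ p ∈ T, (approxCdf n s m (p.1 + p.2) - approxCdf n s m (p.1 - p.2)) := by
        rw [Finset.mul_sum]
    _ ≤ 2 / θ * 1 := by gcongr
    _ = 2 / θ := mul_one _

theorem packingPremeasure_le_packingSup {s δ : ℝ} (hδ : 0 < δ) (E : Set ℝ) :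
    packingPremeasure s E ≤ packingSup s δ E :=
  iInf₂_le δ hδ

theorem packingMeasure_le_packingPremeasure (s : ℝ) (E : Set ℝ) :
    packingMeasure s E ≤ packingPremeasure s E := by
  have hempty : packingPremeasure s ∅ = 0 := by
    refine le_antisymm ((packingPremeasure_le_packingSup one_pos ∅).trans ?_) zero_le
    refine iSup₂_le fun R hR => ?_
    have : R = ∅ := eq_empty_of_forall_notMem fun p hp => hR.center_mem p hp
    subst this
    simp
  refine (iInf₂_le (fun i : ℕ => if i = 0 then E else ∅)
    (subset_iUnion_of_subset 0 (by simp))).trans (le_of_eq ?_)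
  rw [tsum_eq_single 0 fun i hi => by simp [hi, hempty]]
  simp

/-! ### From packing sums to the packing dimension -/

/-- If the packing sums at exponent `s` are bounded, then so is the packing measure at the packing
dimension, provided that the packing measure does not vanish below `s`. -/
theorem packingMeasure_packingDim_le {E : Set ℝ} {s C : ℝ} (hs0 : 0 ≤ s)
    (hC : ∀ δ ≤ 1 / 2, ∀ T : Finset (ℝ × ℝ), IsPacking δ E T → ∑ p ∈ T, (2 * p.2) ^ s ≤ C)
    (hpos : ∀ t, 0 ≤ t → t < s → packingMeasure t E ≠ 0) :
    packingMeasure (packingDim E) E ≤ ENNReal.ofReal C := by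
  have hgt : ∀ h, s ≤ h → ∀ δ, 0 < δ → δ ≤ 1 / 2 →
      packingMeasure h E ≤ ENNReal.ofReal ((2 * δ) ^ (h - s) * C) := by
    intro h hsh δ hδ0 hδ
    refine (packingMeasure_le_packingPremeasure h E).trans
      ((packingPremeasure_le_packingSup hδ0 E).trans
        (packingSup_le_of_finset (hs0.trans hsh) fun T hT => ?_))
    refine le_trans ?_ (mul_le_mul_of_nonneg_left (hC δ hδ T hT) (by positivity))
    rw [Finset.mul_sum]
    refine Finset.sum_le_sum fun p hp => ?_
    have hp0 := hT.radius_pos p hp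
    have hp1 := hT.radius_le p hp
    have h1 : (2 * p.2) ^ h = (2 * p.2) ^ (h - s) * (2 * p.2) ^ s := by
      rw [← Real.rpow_add (by positivity)]; ring_nf
    have h2 : (2 * p.2) ^ (h - s) ≤ (2 * δ) ^ (h - s) :=
      Real.rpow_le_rpow (by positivity) (by linarith) (by linarith)
    rw [h1]
    gcongr
  -- The real infimum defining `packingDim` needs a nonempty set, as `sInf ∅ = 0`.
  have hmem : s + 1 ∈ {t : ℝ | 0 ≤ t ∧ packingMeasure t E = 0} := by
    refine ⟨by linarith, le_antisymm ?_ zero_le⟩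
    have hlim : Tendsto (fun δ : ℝ => ENNReal.ofReal ((2 * δ) ^ (s + 1 - s) * C)) (𝓝[>] 0)
        (𝓝 0) := by
      have : Tendsto (fun δ : ℝ => 2 * δ * C) (𝓝[>] 0) (𝓝 (2 * 0 * C)) :=
        Tendsto.mono_left (Continuous.tendsto (by fun_prop) 0) nhdsWithin_le_nhds
      simpa using ENNReal.tendsto_ofReal this
    refine ge_of_tendsto hlim ?_
    filter_upwards [Ioc_mem_nhdsGT (by norm_num : (0 : ℝ) < 1 / 2)] with δ hδ
    exact hgt (s + 1) (by linarith) δ hδ.1 hδ.2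
  have hdim : s ≤ packingDim E :=
    le_csInf ⟨_, hmem⟩ fun t ht => not_lt.1 fun hts => hpos t ht.1 hts ht.2
  -- At `δ = 1/2` the factor `(2 * δ) ^ (h - s)` is `1`, so equality of `packingDim E` and `s` is
  -- not needed.
  simpa using hgt _ hdim (1 / 2) (by norm_num) le_rfl

/-! ### The similarity dimension and its distance to 1 -/

theorem sum_gaussRatio_rpow_strictAnti {n : ℕ} (hn : 1 ≤ n) :
    StrictAnti fun t : ℝ => ∑ k ∈ Finset.Icc 1 n, gaussRatio k ^ t := by
  intro t u htu
  refine Finset.sum_lt_sum_of_nonempty ⟨1, Finset.mem_Icc.2 ⟨le_rfl, hn⟩⟩ fun k hk => ?_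
  have hk1 := (Finset.mem_Icc.1 hk).1
  exact Real.rpow_lt_rpow_of_exponent_gt (gaussRatio_pos hk1)
    ((gaussRatio_le_half hk1).trans_lt (by norm_num)) htu

/-- The similarity dimension of the system of the first `n` branches. -/
theorem exists_sum_gaussRatio_rpow_eq_one {n : ℕ} (hn : 1 ≤ n) :
    ∃ s : ℝ, 0 ≤ s ∧ s ≤ 1 ∧ ∑ k ∈ Finset.Icc 1 n, gaussRatio k ^ s = 1 := by
  have hcont : Continuous fun t : ℝ => ∑ k ∈ Finset.Icc 1 n, gaussRatio k ^ t :=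
    continuous_finsetSum _ fun k hk =>
      Real.continuous_const_rpow (gaussRatio_pos (Finset.mem_Icc.1 hk).1).ne'
  have h0 : (1 : ℝ) ≤ ∑ k ∈ Finset.Icc 1 n, gaussRatio k ^ (0 : ℝ) := by
    simpa using hn
  have h1 : ∑ k ∈ Finset.Icc 1 n, gaussRatio k ^ (1 : ℝ) ≤ 1 := by
    simp only [Real.rpow_one]
    rw [sum_gaussRatio]
    have : (0 : ℝ) < 1 / ((n : ℝ) + 1) := by positivity
    linarith
  obtain ⟨s, hs, hs'⟩ := intermediate_value_Icc' zero_le_one hcont.continuousOn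
    (show (1 : ℝ) ∈ _ from ⟨h1, h0⟩)
  exact ⟨s, hs.1, hs.2, hs'⟩

/-- Every ratio is at most `1/2`, so each weight exceeds its ratio by a factor at least `2 ^ (1 -
s)`, while the ratios already sum to `n / (n + 1)`. -/
theorem two_rpow_one_sub_le {n : ℕ} (hn : 1 ≤ n) {s : ℝ} (hs1 : s ≤ 1)
    (hs : ∑ k ∈ Finset.Icc 1 n, gaussRatio k ^ s = 1) : (2 : ℝ) ^ (1 - s) ≤ 1 + 1 / n := by
  have hn0 : (0 : ℝ) < n := by exact_mod_cast hn
  have h : (2 : ℝ) ^ (1 - s) * (1 - 1 / ((n : ℝ) + 1)) ≤ 1 := by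
    rw [← sum_gaussRatio, Finset.mul_sum]
    refine le_trans ?_ hs.le
    refine Finset.sum_le_sum fun k hk => ?_
    have hk1 := (Finset.mem_Icc.1 hk).1
    have hp := gaussRatio_pos hk1
    have h1 := Real.rpow_le_rpow_of_nonpos hp (gaussRatio_le_half hk1) (sub_nonpos.2 hs1)
    have h2 : (1 / 2 : ℝ) ^ (s - 1) = 2 ^ (1 - s) := by
      rw [one_div, Real.inv_rpow (by norm_num), ← Real.rpow_neg (by norm_num), neg_sub]
    calc (2 : ℝ) ^ (1 - s) * gaussRatio k ≤ gaussRatio k ^ (s - 1) * gaussRatio k := by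
          rw [← h2]; gcongr
      _ = gaussRatio k ^ s := by rw [← Real.rpow_add_one hp.ne']; simp
  have h3 : 1 - 1 / ((n : ℝ) + 1) = n / (n + 1) := by field_simp; ring
  rw [h3, ← mul_div_assoc, div_le_one (by positivity)] at h
  rw [show 1 + 1 / (n : ℝ) = (n + 1) / n by field_simp, le_div_iff₀ hn0]
  exact h

theorem half_rpow_le {n : ℕ} (hn : 2 ≤ n) {s : ℝ} (hs1 : s ≤ 1)
    (hs : ∑ k ∈ Finset.Icc 1 n, gaussRatio k ^ s = 1) : (1 / 2 : ℝ) ^ s ≤ 3 / 4 := by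
  have h := two_rpow_one_sub_le (by omega) hs1 hs
  have h1 : (1 : ℝ) / n ≤ 1 / 2 := one_div_le_one_div_of_le (by norm_num) (by exact_mod_cast hn)
  rw [Real.rpow_sub (by norm_num), Real.rpow_one] at h
  rw [one_div, Real.inv_rpow (by norm_num), ← one_div]
  have h2 : (2 : ℝ) / 2 ^ s = 2 * (1 / 2 ^ s) := by ring
  linarith

theorem gaussRatio_rpow_sub_one_le {n : ℕ} (hn : 1 ≤ n) {s : ℝ} (hs1 : s ≤ 1)
    (hs : ∑ k ∈ Finset.Icc 1 n, gaussRatio k ^ s = 1) :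
    gaussRatio n ^ (s - 1) ≤ Real.exp (4 * (Real.log ((n : ℝ) + 1) / n)) := by
  have hn1 : (1 : ℝ) ≤ n := by exact_mod_cast hn
  -- From `1 + x ≤ exp x` and `log 2 > 1/2`.
  have h1s : 1 - s ≤ 2 / n := by
    have h := two_rpow_one_sub_le hn hs1 hs
    rw [Real.rpow_def_of_pos (by norm_num)] at h
    have h1 := Real.add_one_le_exp (Real.log 2 * (1 - s))
    have h2 := Real.log_two_gt_d9
    have h3 : (2 : ℝ) / n = 2 * (1 / n) := by ring
    nlinarith
  have hlog : Real.log (gaussRatio n) = -(Real.log n + Real.log ((n : ℝ) + 1)) := by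
    rw [gaussRatio, one_div, Real.log_inv, Real.log_mul (by positivity) (by positivity)]
  have h2 : Real.log n ≤ Real.log ((n : ℝ) + 1) := Real.log_le_log (by positivity) (by linarith)
  have h3 : 0 ≤ Real.log n := Real.log_nonneg hn1
  rw [Real.rpow_def_of_pos (gaussRatio_pos hn), Real.exp_le_exp, hlog]
  calc -(Real.log n + Real.log ((n : ℝ) + 1)) * (s - 1)
      = (Real.log n + Real.log ((n : ℝ) + 1)) * (1 - s) := by ring
    _ ≤ (Real.log ((n : ℝ) + 1) + Real.log ((n : ℝ) + 1)) * (2 / n) := by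
        gcongr
        linarith
    _ = 4 * (Real.log ((n : ℝ) + 1) / n) := by ring

theorem tendsto_exp_log_div :
    Tendsto (fun n : ℕ => Real.exp (4 * (Real.log ((n : ℝ) + 1) / n))) atTop (𝓝 1) := by
  have h := (Real.tendsto_pow_log_div_mul_add_atTop 1 (-1) 1 one_ne_zero).comp
    (tendsto_atTop_add_const_right atTop (1 : ℝ) tendsto_natCast_atTop_atTop)
  have h' : Tendsto (fun n : ℕ => 4 * (Real.log ((n : ℝ) + 1) / n)) atTop (𝓝 (4 * 0)) := by
    refine Tendsto.const_mul 4 (h.congr fun n => ?_)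
    simp [Function.comp]
  have h'' := (Real.continuous_exp.tendsto _).comp h'
  rwa [mul_zero, Real.exp_zero] at h''

theorem packingMeasure_packingDim_limitSet_le {n : ℕ} (hn : 2 ≤ n) {u θ : ℝ}
    (hu : u = Real.exp (4 * (Real.log ((n : ℝ) + 1) / n)))
    (hθ : θ = (1 - 16 / ((n : ℝ) + 1) * u) / u) (hθ0 : 0 < θ) :
    packingMeasure (packingDim (limitSet n)) (limitSet n) ≤ ENNReal.ofReal (2 / θ) := by
  have hn1 : 1 ≤ n := by omega
  obtain ⟨s, hs0, hs1, hs⟩ := exists_sum_gaussRatio_rpow_eq_one hn1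
  have hκ := gaussRatio_rpow_sub_one_le hn1 hs1 hs
  rw [← hu] at hκ
  have hu0 : 0 < u := hu ▸ Real.exp_pos _
  refine packingMeasure_packingDim_le hs0 (fun δ hδ => sum_packing_limitSet_le hn1 hs0 hs1
    (half_rpow_le hn hs1 hs) hs hθ0 ?_ hδ) fun t ht0 hts => ?_
  · calc θ * gaussRatio n ^ (s - 1) ≤ θ * u := by gcongr
      _ = 1 - 16 / ((n : ℝ) + 1) * u := by rw [hθ, div_mul_cancel₀ _ hu0.ne']
      _ ≤ _ := by gcongr
  · rw [packingMeasure_limitSet_eq_top hn1 ht0 (hs ▸ sum_gaussRatio_rpow_strictAnti hn1 hts)]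
    exact ENNReal.top_ne_zero

end

/-! ### The limit `n → ∞` -/

theorem mainTheorem3 :
    limsup (fun n : ℕ => packingMeasure (packingDim (limitSet n)) (limitSet n)) atTop
      ≤ (2 : ℝ≥0∞) := by
  have hu := tendsto_exp_log_div
  have h16 : Tendsto (fun n : ℕ => (16 : ℝ) / ((n : ℝ) + 1)) atTop (𝓝 0) :=
    (tendsto_atTop_add_const_right atTop (1 : ℝ) tendsto_natCast_atTop_atTop).const_div_atTop 16
  have hθ := ((h16.mul hu).const_sub 1).div hu one_ne_zero
  rw [zero_mul, sub_zero, div_one] at hθ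
  have hC := ENNReal.tendsto_ofReal ((tendsto_const_nhds (x := (2 : ℝ))).div hθ one_ne_zero)
  rw [div_one, ENNReal.ofReal_ofNat] at hC
  rw [← hC.limsup_eq]
  refine limsup_le_limsup ?_
  filter_upwards [eventually_ge_atTop 2, hθ.eventually_const_lt zero_lt_one] with n hn hpos
  exact packingMeasure_packingDim_limitSet_le hn rfl rfl hpos
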